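/- **Theorem 6.** Let $a,b>0$ and let $X_1,X_2,\ldots$ be i.i.d. real random variables with the symmetric variance-gamma law with shape $a$, scale $b$ and location $m=0$, that is, the law of $\sqrt{bG}\,Z$ with $G\sim\Gamma(a,1)$ and $Z\sim\mathcal N(0,1)$ independent. For $x>0$ put $$L(x)=\tfrac12\ln\tfrac{\pi}{2}+\tfrac12\ln x+\ln\Gamma(x)-\ln\Gamma\left(x+\tfrac12\right).$$ Then $L$ maps $(0,\infty)$ bijectively onto $\left(\tfrac12\ln\tfrac\pi2,\infty\right)$; let $\ell$ be its inverse there, extended by an arbitrary constant outside $\left(\tfrac12\ln\tfrac\pi2,\infty\right)$. For $N\ge1$ put $$\hat A'=\frac1N\sum_{j=1}^N|X_j|,\qquad \hat V'=\frac1N\sum_{j=1}^N X_j^2,\qquad \hat a'=\ell\left(\tfrac12\ln\hat V'-\ln\hat A'\right),\qquad \hat b=\frac{\hat V'}{\hat a'}.$$ Then: 1. almost surely $\tfrac12\ln\hat V'-\ln\hat A'>\tfrac12\ln\tfrac\pi2$ for all sufficiently large $N$ (so that the estimators are given by the true inverse of $L$); 2. (consistency) $(\hat a',\hat b)\to(a,b)$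 almost surely as $N\to\infty$; 3. (asymptotic normality) there is a positive semidefinite $2\times2$ matrix $\Sigma$, depending only on $a$ and $b$, such that $\sqrt N\,[(\hat a',\hat b)-(a,b)]\to\mathcal N_2(0,\Sigma)$ in distribution as $N\to\infty$. -/

import Mathlib

open MeasureTheory ProbabilityTheory Filter Topology

universe u

/-- The symmetric variance-gamma (generalized Laplace) law with shape `a`, scale `b` and location
`m`: the law of `m + √(b G) Z` with `G ∼ Γ(a, 1)` and `Z ∼ N(0, 1)` independent. -/
noncomputable def svgMeasure (a b m : ℝ) : Measure ℝ :=
  ((gammaMeasure a 1).prod (gaussianReal 0 1)).map fun p => m + √(b * p.1) * p.2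

/-- The function `L(x) = ½ ln(π/2) + ½ ln x + ln Γ(x) - ln Γ(x + ½)`, of interest for `x > 0`. -/
noncomputable def svgL (x : ℝ) : ℝ :=
  1 / 2 * Real.log (Real.pi / 2) + 1 / 2 * Real.log x + Real.log (Real.Gamma x)
    - Real.log (Real.Gamma (x + 1 / 2))

/-- The inverse `ℓ` of the restriction of `L` to `(0, ∞)`; off the range of that restriction its
value is an unspecified constant. -/
noncomputable def svgEll : ℝ → ℝ := Function.invFunOn svgL (Set.Ioi 0)

/-- The empirical absolute first moment `Â'` of the first `N` observations. -/
noncomputable def empAbsMoment (x : ℕ → ℝ) (N : ℕ) : ℝ :=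
  (∑ j ∈ Finset.range N, |x j|) / N

/-- The empirical second moment `V̂'` of the first `N` observations. -/
noncomputable def empSecondMoment (x : ℕ → ℝ) (N : ℕ) : ℝ :=
  (∑ j ∈ Finset.range N, x j ^ 2) / N

/-- The statistic `½ ln V̂' - ln Â'`. -/
noncomputable def empLogRatio (x : ℕ → ℝ) (N : ℕ) : ℝ :=
  1 / 2 * Real.log (empSecondMoment x N) - Real.log (empAbsMoment x N)

/-- The shape estimator `â' = ℓ(½ ln V̂' - ln Â')`. -/
noncomputable def shapeEst (x : ℕ → ℝ) (N : ℕ) : ℝ := svgEll (empLogRatio x N)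

/-- The scale estimator `b̂ = V̂' / â'`. -/
noncomputable def scaleEst (x : ℕ → ℝ) (N : ℕ) : ℝ := empSecondMoment x N / shapeEst x N

/-! The scale cancels from `½ ln E[X²] - ln E|X|`, which equals `L(a)`, while `E[X²] = ab`. So `(a,
b)` is a function `momentEst` of the moments `(E|X|, E[X²])`, and the estimators are the same
function of the empirical moments. The strong law with continuity gives consistency; the central
limit theorem for `(|X|, X²)` with the delta method gives normality, `Σ` being the covariance of a
Gaussian pushed forward by the derivative of `momentEst`.

What remains is that `ℓ` is differentiable at `L(a)`, that is, `L` is a decreasing bijection with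
`L' < 0`. The functional equation of `Γ` makes `D(x) = L(x) - L(x + 1)` elementary and strictly
decreasing, and log-convexity of `Γ` gives `L → ½ ln(π/2)` at infinity. In effect `L` is this limit
plus `∑ D(x + n)`, a sum of strictly decreasing terms. -/

/-! ### Monotonicity and range of `L` -/

lemma Real.log_Gamma_add_one {x : ℝ} (hx : 0 < x) :
    Real.log (Real.Gamma (x + 1)) = Real.log x + Real.log (Real.Gamma x) := by
  rw [Real.Gamma_add_one hx.ne', Real.log_mul hx.ne' (Real.Gamma_pos_of_pos hx).ne']

lemma Real.log_Gamma_midpoint_le {x y : ℝ} (hx : 0 < x) (hy : 0 < y) :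
    Real.log (Real.Gamma ((x + y) / 2)) ≤
      (Real.log (Real.Gamma x) + Real.log (Real.Gamma y)) / 2 := by
  have h := Real.convexOn_log_Gamma.2 (Set.mem_Ioi.2 hx) (Set.mem_Ioi.2 hy)
    (by norm_num : (0 : ℝ) ≤ 1 / 2) (by norm_num : (0 : ℝ) ≤ 1 / 2) (by norm_num)
  simp only [smul_eq_mul, Function.comp_apply] at h
  rw [show 1 / 2 * x + 1 / 2 * y = (x + y) / 2 by ring] at h
  linarith

/-- The increment `L(x) - L(x + 1)`, in closed form. -/
noncomputable def svgLDrop (x : ℝ) : ℝ :=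
  Real.log (x + 1 / 2) - 1 / 2 * Real.log x - 1 / 2 * Real.log (x + 1)

lemma svgL_sub_svgL_add_one {x : ℝ} (hx : 0 < x) : svgL x - svgL (x + 1) = svgLDrop x := by
  have h1 := Real.log_Gamma_add_one hx
  have h2 := Real.log_Gamma_add_one (x := x + 1 / 2) (by linarith)
  rw [show x + 1 / 2 + 1 = x + 1 + 1 / 2 by ring] at h2
  simp only [svgL, svgLDrop]
  linarith

lemma hasDerivAt_svgLDrop {x : ℝ} (hx : 0 < x) :
    HasDerivAt svgLDrop ((x + 1 / 2)⁻¹ - 1 / 2 * x⁻¹ - 1 / 2 * (x + 1)⁻¹) x := by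
  have h1 : HasDerivAt (fun x : ℝ => Real.log (x + 1 / 2)) ((x + 1 / 2)⁻¹) x := by
    simpa using ((hasDerivAt_id x).add_const (1 / 2 : ℝ)).log (by simp; positivity)
  have h2 : HasDerivAt (fun x : ℝ => Real.log (x + 1)) ((x + 1)⁻¹) x := by
    simpa using ((hasDerivAt_id x).add_const (1 : ℝ)).log (by simp; positivity)
  exact (h1.sub ((Real.hasDerivAt_log hx.ne').const_mul (1 / 2))).sub (h2.const_mul (1 / 2))

/-- Strict convexity of `1/t` at the midpoint `x + 1/2` of `x` and `x + 1`. -/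
lemma svgLDrop_deriv_neg {x : ℝ} (hx : 0 < x) :
    (x + 1 / 2)⁻¹ - 1 / 2 * x⁻¹ - 1 / 2 * (x + 1)⁻¹ < 0 := by
  have : (x + 1 / 2)⁻¹ - 1 / 2 * x⁻¹ - 1 / 2 * (x + 1)⁻¹
      = -(1 / (4 * (x * (x + 1) * (x + 1 / 2)))) := by
    field_simp
    ring
  rw [this]
  have : 0 < 1 / (4 * (x * (x + 1) * (x + 1 / 2))) := by positivity
  linarith

lemma strictAntiOn_svgLDrop : StrictAntiOn svgLDrop (Set.Ioi 0) := by
  refine strictAntiOn_of_deriv_neg (convex_Ioi 0)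
    (fun x hx => (hasDerivAt_svgLDrop hx).continuousAt.continuousWithinAt) fun x hx => ?_
  rw [interior_Ioi] at hx
  rw [(hasDerivAt_svgLDrop hx).deriv]
  exact svgLDrop_deriv_neg hx

/-- Log-convexity of `Γ` at the midpoint of `x` and `x + 1`. -/
lemma le_svgL {x : ℝ} (hx : 0 < x) : 1 / 2 * Real.log (Real.pi / 2) ≤ svgL x := by
  have h := Real.log_Gamma_midpoint_le hx (by linarith : 0 < x + 1)
  rw [Real.log_Gamma_add_one hx, show (x + (x + 1)) / 2 = x + 1 / 2 by ring] at h
  simp only [svgL]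
  linarith

/-- Log-convexity of `Γ` at `x`, the midpoint of `x - 1/2` and `x + 1/2`. -/
lemma svgL_le {x : ℝ} (hx : 1 / 2 < x) :
    svgL x ≤ 1 / 2 * Real.log (Real.pi / 2) + 1 / 2 * Real.log (x / (x - 1 / 2)) := by
  have h := Real.log_Gamma_midpoint_le (x := x - 1 / 2) (y := x - 1 / 2 + 1)
    (by linarith) (by linarith)
  rw [Real.log_Gamma_add_one (by linarith), show (x - 1 / 2 + (x - 1 / 2 + 1)) / 2 = x by ring] at h
  have h2 := Real.log_Gamma_add_one (x := x - 1 / 2) (by linarith)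
  rw [show x - 1 / 2 + 1 = x + 1 / 2 by ring] at h2
  rw [Real.log_div (x := x) (by linarith) (by linarith)]
  simp only [svgL]
  linarith

lemma tendsto_svgL_atTop : Tendsto svgL atTop (𝓝 (1 / 2 * Real.log (Real.pi / 2))) := by
  have h : Tendsto (fun x : ℝ => x / (x - 1 / 2)) atTop (𝓝 1) := by
    have h1 : Tendsto (fun x : ℝ => 1 + 1 / 2 * (x - 1 / 2)⁻¹) atTop (𝓝 (1 + 1 / 2 * 0)) :=
      ((tendsto_inv_atTop_zero.comp (tendsto_atTop_add_const_right atTop (-(1 / 2 : ℝ))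
        tendsto_id)).const_mul _).const_add _
    rw [mul_zero, add_zero] at h1
    refine h1.congr' ?_
    filter_upwards [eventually_gt_atTop (1 / 2 : ℝ)] with x hx
    rw [eq_div_iff (by linarith), add_mul, mul_assoc, inv_mul_cancel₀ (by linarith)]
    ring
  have h2 := ((h.log one_ne_zero).const_mul (1 / 2)).const_add (1 / 2 * Real.log (Real.pi / 2))
  rw [Real.log_one, mul_zero, add_zero] at h2
  refine tendsto_of_tendsto_of_tendsto_of_le_of_le' tendsto_const_nhds h2 ?_ ?_
  · filter_upwards [eventually_gt_atTop 0] with x hx using le_svgL hx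
  · filter_upwards [eventually_gt_atTop (1 / 2)] with x hx using svgL_le hx

/-- Telescoping: the two sides differ by the sum of `D(x + k) - D(y + k) ≥ 0` over `k < n`. As `n →
∞` the left side vanishes, which gives monotonicity of `L`. -/
lemma svgL_sub_antitone_step {x y : ℝ} (hx : 0 < x) (hxy : x ≤ y) (n : ℕ) :
    svgL (x + n) - svgL (y + n) ≤ svgL x - svgL y := by
  induction n with
  | zero => simp
  | succ n ih =>
    have hn : (0 : ℝ) ≤ n := n.cast_nonneg
    have h1 := svgL_sub_svgL_add_one (x := x + n) (by linarith)
    have h2 := svgL_sub_svgL_add_one (x := y + n) (by linarith)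
    have h3 := strictAntiOn_svgLDrop.antitoneOn (Set.mem_Ioi.2 (by linarith : 0 < x + n))
      (Set.mem_Ioi.2 (by linarith : 0 < y + n)) (by linarith : x + n ≤ y + n)
    push_cast
    rw [← add_assoc, ← add_assoc]
    linarith

lemma antitoneOn_svgL : AntitoneOn svgL (Set.Ioi 0) := by
  intro x hx y hy hxy
  have h (z : ℝ) : Tendsto (fun n : ℕ => svgL (z + n)) atTop
      (𝓝 (1 / 2 * Real.log (Real.pi / 2))) :=
    tendsto_svgL_atTop.comp (tendsto_atTop_add_const_left _ _ tendsto_natCast_atTop_atTop)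
  have h0 := (h x).sub (h y)
  rw [sub_self] at h0
  exact sub_nonneg.1 (le_of_tendsto' h0 (svgL_sub_antitone_step hx hxy))

/-- The difference is `L(x + 1)`. Hence `L` decreases at least as fast as `D`, which yields both
strict monotonicity and `L' ≤ D' < 0`. -/
lemma antitoneOn_svgL_sub_svgLDrop : AntitoneOn (fun x => svgL x - svgLDrop x) (Set.Ioi 0) := by
  refine (show AntitoneOn (fun x => svgL (x + 1)) (Set.Ioi 0) from fun x hx y hy hxy => ?_).congr
    fun x hx => by simp [← svgL_sub_svgL_add_one (Set.mem_Ioi.1 hx)]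
  exact antitoneOn_svgL (Set.mem_Ioi.2 (by linarith [Set.mem_Ioi.1 hx]))
    (Set.mem_Ioi.2 (by linarith [Set.mem_Ioi.1 hy])) (by linarith)

lemma strictAntiOn_svgL : StrictAntiOn svgL (Set.Ioi 0) := by
  intro x hx y hy hxy
  have h1 := antitoneOn_svgL_sub_svgLDrop hx hy hxy.le
  have h2 := strictAntiOn_svgLDrop hx hy hxy
  simp only at h1
  linarith

lemma differentiableAt_log_Gamma {x : ℝ} (hx : 0 < x) :
    DifferentiableAt ℝ (fun x => Real.log (Real.Gamma x)) x :=
  (Real.differentiableAt_Gamma fun m => by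
    have : (0 : ℝ) ≤ m := m.cast_nonneg
    linarith).log (Real.Gamma_pos_of_pos hx).ne'

lemma differentiableAt_svgL {x : ℝ} (hx : 0 < x) : DifferentiableAt ℝ svgL x := by
  have h1 := differentiableAt_log_Gamma hx
  have h2 : DifferentiableAt ℝ (fun x => Real.log (Real.Gamma (x + 1 / 2))) x :=
    differentiableAt_comp_add_const.2
      (differentiableAt_log_Gamma (by linarith : 0 < x + 1 / 2))
  have h3 := (Real.differentiableAt_log hx.ne').const_mul (1 / 2)
  exact ((h3.const_add _).add h1).sub h2

lemma deriv_svgL_neg {x : ℝ} (hx : 0 < x) : deriv svgL x < 0 := by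
  have h1 := (differentiableAt_svgL hx).hasDerivAt.sub (hasDerivAt_svgLDrop hx)
  have h2 := antitoneOn_svgL_sub_svgLDrop.derivWithin_nonpos (x := x)
  rw [derivWithin_of_isOpen isOpen_Ioi hx] at h2
  have h3 := h1.deriv
  have h4 := svgLDrop_deriv_neg hx
  change deriv (fun x => svgL x - svgLDrop x) x = _ at h3
  linarith

lemma lt_svgL {x : ℝ} (hx : 0 < x) : 1 / 2 * Real.log (Real.pi / 2) < svgL x :=
  (le_svgL (by linarith : 0 < x + 1)).trans_lt
    (strictAntiOn_svgL hx (Set.mem_Ioi.2 (by linarith)) (by linarith))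

/-- Since `ln Γ(x) = ln Γ(x + 1) - ln x`, near zero `L` is `-½ ln x` plus a function continuous at
zero. -/
lemma tendsto_svgL_nhdsGT_zero : Tendsto svgL (𝓝[>] 0) atTop := by
  have hc : Tendsto (fun x => 1 / 2 * Real.log (Real.pi / 2) + Real.log (Real.Gamma (x + 1))
      - Real.log (Real.Gamma (x + 1 / 2))) (𝓝[>] 0)
      (𝓝 (1 / 2 * Real.log (Real.pi / 2) + Real.log (Real.Gamma (0 + 1))
        - Real.log (Real.Gamma (0 + 1 / 2)))) := by
    refine tendsto_nhdsWithin_of_tendsto_nhds (ContinuousAt.tendsto ?_)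
    have h (c : ℝ) (hc : 0 < c) : ContinuousAt (fun x => Real.log (Real.Gamma (x + c))) 0 :=
      (differentiableAt_comp_add_const.2
        (differentiableAt_log_Gamma (by linarith : 0 < 0 + c))).continuousAt
    exact ((h 1 one_pos).const_add _).sub (h (1 / 2) (by norm_num))
  have hl : Tendsto (fun x => -(1 / 2) * Real.log x) (𝓝[>] 0) atTop :=
    Real.tendsto_log_nhdsGT_zero.const_mul_atBot_of_neg (by norm_num)
  refine (hl.atTop_add hc).congr' ?_
  filter_upwards [self_mem_nhdsWithin] with x hx
  have := Real.log_Gamma_add_one hx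
  simp only [svgL]
  linarith

lemma continuousOn_svgL : ContinuousOn svgL (Set.Ioi 0) :=
  fun _ hx => (differentiableAt_svgL hx).continuousAt.continuousWithinAt

lemma bijOn_svgL :
    Set.BijOn svgL (Set.Ioi 0) (Set.Ioi (1 / 2 * Real.log (Real.pi / 2))) := by
  refine ⟨fun x hx => lt_svgL hx, strictAntiOn_svgL.injOn, ?_⟩
  exact isPreconnected_Ioi.intermediate_value_Ioi (l₁ := atTop) (l₂ := 𝓝[>] 0)
    (le_principal_iff.2 (Ioi_mem_atTop 0)) inf_le_right continuousOn_svgL tendsto_svgL_atTop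
    tendsto_svgL_nhdsGT_zero

/-! ### Regularity of the inverse `ℓ` -/

lemma svgEll_pos {y : ℝ} (hy : 1 / 2 * Real.log (Real.pi / 2) < y) : 0 < svgEll y :=
  bijOn_svgL.surjOn.mapsTo_invFunOn hy

lemma svgL_svgEll {y : ℝ} (hy : 1 / 2 * Real.log (Real.pi / 2) < y) : svgL (svgEll y) = y :=
  bijOn_svgL.surjOn.rightInvOn_invFunOn hy

lemma svgEll_svgL {x : ℝ} (hx : 0 < x) : svgEll (svgL x) = x :=
  bijOn_svgL.injOn.leftInvOn_invFunOn hx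

lemma antitoneOn_svgEll : AntitoneOn svgEll (Set.Ioi (1 / 2 * Real.log (Real.pi / 2))) := by
  intro x hx y hy hxy
  rwa [← strictAntiOn_svgL.le_iff_ge (svgEll_pos hx) (svgEll_pos hy), svgL_svgEll hx,
    svgL_svgEll hy]

lemma continuousAt_svgEll {y : ℝ} (hy : 1 / 2 * Real.log (Real.pi / 2) < y) :
    ContinuousAt svgEll y := by
  -- `-ℓ` is monotone and its image contains every negative number, so it cannot jump.
  rw [← continuousAt_neg_iff]
  refine continuousAt_of_monotoneOn_of_image_mem_nhds antitoneOn_svgEll.neg (Ioi_mem_nhds hy) ?_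
  refine Filter.mem_of_superset (Iio_mem_nhds (neg_lt_zero.2 (svgEll_pos hy))) fun z hz => ?_
  have hz' : 0 < -z := neg_pos.2 hz
  exact ⟨svgL (-z), lt_svgL hz', by simp [svgEll_svgL hz']⟩

lemma hasDerivAt_svgEll {x : ℝ} (hx : 0 < x) :
    HasDerivAt svgEll (deriv svgL x)⁻¹ (svgL x) := by
  refine HasDerivAt.of_local_left_inverse (f := svgL) (continuousAt_svgEll (lt_svgL hx)) ?_
    (deriv_svgL_neg hx).ne ?_
  · rw [svgEll_svgL hx]
    exact (differentiableAt_svgL hx).hasDerivAt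
  · filter_upwards [Ioi_mem_nhds (lt_svgL hx)] with y hy using svgL_svgEll hy

lemma measurable_svgEll : Measurable svgEll := by
  set s := Set.Ioi (1 / 2 * Real.log (Real.pi / 2))
  refine measurable_of_restrict_of_restrict_compl (s := s) measurableSet_Ioi ?_ ?_
  · exact (continuousOn_iff_continuous_domRestrict.1 fun y hy =>
      (continuousAt_svgEll hy).continuousWithinAt).measurable
  -- Off the range of `L`, `Function.invFunOn` returns one fixed default value.
  · have h : ∀ y : (sᶜ : Set ℝ), sᶜ.domRestrict svgEll y = Classical.choice ⟨(0 : ℝ)⟩ := fun y => by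
      refine Function.invFunOn_neg fun ⟨x, hx, hxy⟩ => y.2 ?_
      rw [← hxy]
      exact lt_svgL hx
    rw [funext h]
    exact measurable_const

/-! ### Vector central limit theorem, delta method, Gaussian laws -/

section LimitTheorems

variable {Ω Ω' : Type*} {mΩ : MeasurableSpace Ω} {mΩ' : MeasurableSpace Ω'}
  {P : Measure Ω} {P' : Measure Ω'}

/-- The Cramér–Wold reduction of a vector limit theorem to its one-dimensional projections. -/
lemma charFun_map_inner {E : Type*} [NormedAddCommGroup E] [InnerProductSpace ℝ E]
    [MeasurableSpace E] [BorelSpace E] {Y : Ω → E} (hY : AEMeasurable Y P) (t : E) :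
    charFun (P.map Y) t = charFun (P.map fun ω => inner ℝ t (Y ω)) 1 := by
  have h : AEMeasurable (fun ω => inner ℝ t (Y ω)) P :=
    (innerSL ℝ t).continuous.measurable.comp_aemeasurable hY
  rw [charFun_apply, charFun_apply_real, integral_map hY (by fun_prop),
    integral_map h (by fun_prop)]
  simp [real_inner_comm]

variable [IsProbabilityMeasure P] [IsProbabilityMeasure P']

/-- **Central limit theorem** for i.i.d. square integrable random vectors. -/
theorem tendstoInDistribution_inv_sqrt_smul_sum_sub {E : Type*} [NormedAddCommGroup E]
    [InnerProductSpace ℝ E] [FiniteDimensional ℝ E] [MeasurableSpace E] [BorelSpace E]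
    {Y : ℕ → Ω → E} {γ : Measure E} [IsGaussian γ] {Z : Ω' → E} (hZ : HasLaw Z γ P')
    (hγ : ∫ x, x ∂γ = 0) (hcov : ∀ t, covarianceBilin γ t t = Var[fun ω => inner ℝ t (Y 0 ω); P])
    (hY : MemLp (Y 0) 2 P) (hindep : iIndepFun Y P)
    (hident : ∀ i, IdentDistrib (Y i) (Y 0) P P) :
    TendstoInDistribution
      (fun (n : ℕ) ω => (√n)⁻¹ • (∑ k ∈ Finset.range n, Y k ω - (n : ℝ) • P[Y 0]))
      atTop Z (fun _ => P) P' where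
  forall_aemeasurable n := by
    have := fun i => (hident i).aemeasurable_fst
    fun_prop
  aemeasurable_limit := hZ.aemeasurable
  tendsto := by
    refine ProbabilityMeasure.tendsto_iff_tendsto_charFun.2 fun t => ?_
    have hm : ∀ i, AEMeasurable (Y i) P := fun i => (hident i).aemeasurable_fst
    have hint : Integrable (Y 0) P := hY.integrable (by norm_num)
    have hlin : Measurable fun y : E => inner ℝ t y := (innerSL ℝ t).continuous.measurable
    have h1 := tendstoInDistribution_inv_sqrt_mul_sum_sub (P := P)
      (X := fun k ω => inner ℝ t (Y k ω)) (HasLaw.id (μ := gaussianReal 0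
        Var[fun ω => inner ℝ t (Y 0 ω); P].toNNReal)) (hY.const_inner t)
      (hindep.comp (fun _ y => inner ℝ t y) fun _ => hlin)
      (fun i => (hident i).comp hlin)
    have h2 := ProbabilityMeasure.tendsto_iff_tendsto_charFun.1 h1.tendsto 1
    have hmean : ∫ ω, inner ℝ t (Y 0 ω) ∂P = inner ℝ t (P[Y 0]) := integral_inner hint t
    simp only [ProbabilityMeasure.coe_mk] at h2 ⊢
    rw [Measure.map_id, charFun_gaussianReal] at h2
    rw [hZ.map_eq, IsGaussian.charFun_eq', hcov]
    have hγ' : ∫ x, id x ∂γ = 0 := hγ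
    rw [hγ']
    convert! h2 using 2 with n
    · rw [charFun_map_inner (by fun_prop)]
      congr 3 with ω
      rw [hmean]
      simp [inner_smul_right, inner_sub_right, inner_sum]
    · simp [variance_nonneg]

/-- **Delta method**: the limit law of a consistent, rescaled estimator is transported by
the derivative of a differentiable map. -/
theorem MeasureTheory.TendstoInDistribution.of_hasFDerivAt {E F : Type*} [NormedAddCommGroup E]
    [NormedSpace ℝ E] [SecondCountableTopology E] [MeasurableSpace E] [BorelSpace E]
    [NormedAddCommGroup F] [NormedSpace ℝ F] [SecondCountableTopology F] [MeasurableSpace F]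
    [BorelSpace F] {T : ℕ → Ω → E} {θ : E} {Z : Ω' → E}
    (h : TendstoInDistribution (fun (n : ℕ) ω => √(n : ℝ) • (T n ω - θ)) atTop Z (fun _ => P) P')
    (hTm : ∀ n, AEMeasurable (T n) P)
    (hT : ∀ᵐ ω ∂P, Tendsto (fun n => T n ω) atTop (𝓝 θ))
    {g : E → F} {g' : E →L[ℝ] F} (hg : Measurable g) (hg' : HasFDerivAt g g' θ) :
    TendstoInDistribution (fun (n : ℕ) ω => √(n : ℝ) • (g (T n ω) - g θ)) atTop
      (fun ω => g' (Z ω)) (fun _ => P) P' := by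
  -- Normalised Taylor remainder: with `W = √n (T - θ)`, one has `√n (g T - g θ) = g' W + ‖W‖ r(T)`.
  -- As `r(T) → 0` in probability, Slutsky's theorem removes the last term.
  let r : E → F := fun x => ‖x - θ‖⁻¹ • (g x - g θ - g' (x - θ))
  have hr : Tendsto r (𝓝 θ) (𝓝 0) := by
    rw [tendsto_zero_iff_norm_tendsto_zero]
    simpa [r, norm_smul] using hasFDerivAt_iff_tendsto.1 hg'
  have hrm : Measurable r := by
    have := g'.continuous.measurable
    fun_prop
  have hY : TendstoInMeasure P (fun n ω => r (T n ω)) atTop fun _ => 0 :=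
    tendstoInMeasure_of_tendsto_ae
      (fun n => (hrm.comp_aemeasurable (hTm n)).aestronglyMeasurable)
      (hT.mono fun ω hω => hr.comp hω)
  have key := h.continuous_comp_prodMk_of_tendstoInMeasure_const
    (g := fun p : E × F => g' p.1 + ‖p.1‖ • p.2) (by fun_prop) hY
    (fun n => hrm.comp_aemeasurable (hTm n))
  convert key using 3 with n ω
  · simp only [r, map_smul, norm_smul, Real.norm_eq_abs, abs_of_nonneg (Real.sqrt_nonneg _)]
    rcases eq_or_ne (T n ω) θ with h0 | h0
    · simp [h0]
    · rw [smul_smul, mul_assoc, mul_inv_cancel₀ (norm_ne_zero_iff.2 (sub_ne_zero.2 h0)), mul_one,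
        ← smul_add, add_sub_cancel]
  · simp

/-- The matrix of the covariance form of a measure in the standard basis. -/
noncomputable def covarianceMatrix {ι : Type*} [Fintype ι] [DecidableEq ι]
    (ν : Measure (EuclideanSpace ℝ ι)) : Matrix ι ι ℝ :=
  .of fun i j => covarianceBilin ν (EuclideanSpace.basisFun ι ℝ i) (EuclideanSpace.basisFun ι ℝ j)

lemma dotProduct_covarianceMatrix_mulVec {ι : Type*} [Fintype ι] [DecidableEq ι]
    (ν : Measure (EuclideanSpace ℝ ι)) (x y : EuclideanSpace ℝ ι) :
    x.ofLp ⬝ᵥ (covarianceMatrix ν).mulVec y.ofLp = covarianceBilin ν x y := by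
  conv_rhs => rw [← (EuclideanSpace.basisFun ι ℝ).sum_repr x,
    ← (EuclideanSpace.basisFun ι ℝ).sum_repr y]
  simp [dotProduct, Matrix.mulVec, covarianceMatrix, Finset.mul_sum, mul_comm, mul_left_comm]
  exact Finset.sum_comm

lemma posSemidef_covarianceMatrix {ι : Type*} [Fintype ι] [DecidableEq ι]
    (ν : Measure (EuclideanSpace ℝ ι)) : (covarianceMatrix ν).PosSemidef := by
  refine .of_dotProduct_mulVec_nonneg ?_ fun x => ?_
  · ext i j
    simp [covarianceMatrix, covarianceBilin_comm]
  · have := dotProduct_covarianceMatrix_mulVec ν (WithLp.toLp 2 x) (WithLp.toLp 2 x)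
    simp only [star_trivial]
    rw [this]
    exact covarianceBilin_self_nonneg _

/-- A Gaussian law is determined by its mean and covariance; this names the delta-method limit. -/
lemma ProbabilityTheory.IsGaussian.eq_multivariateGaussian {ι : Type*} [Fintype ι] [DecidableEq ι]
    (ν : Measure (EuclideanSpace ℝ ι)) [IsGaussian ν] :
    ν = multivariateGaussian (∫ x, x ∂ν) (covarianceMatrix ν) := by
  refine IsGaussian.ext (by simp) ?_
  ext x y
  rw [covarianceBilin_multivariateGaussian (posSemidef_covarianceMatrix ν),
    dotProduct_covarianceMatrix_mulVec]

end LimitTheorems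

/-! ### Moments of the gamma, Gaussian and variance-gamma laws -/

lemma integral_gammaMeasure (a r : ℝ) (ha : 0 < a) (hr : 0 < r) (f : ℝ → ℝ) :
    ∫ x, f x ∂gammaMeasure a r =
      ∫ x in Set.Ioi 0, r ^ a / Real.Gamma a * (x ^ (a - 1) * Real.exp (-(r * x))) * f x := by
  rw [gammaMeasure, integral_withDensity_eq_integral_toReal_smul
    (f := gammaPDF a r) (measurable_gammaPDFReal a r).ennreal_ofReal (by simp [gammaPDF]),
    ← integral_Ici_eq_integral_Ioi, ← integral_indicator measurableSet_Ici]
  congr with x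
  rw [gammaPDF, ENNReal.toReal_ofReal (gammaPDFReal_nonneg ha hr x), gammaPDFReal]
  by_cases hx : 0 ≤ x
  · simp [Set.indicator, hx, mul_assoc]
  · simp [Set.indicator, hx]

lemma ae_pos_gammaMeasure (a r : ℝ) : ∀ᵐ x ∂gammaMeasure a r, 0 < x := by
  rw [gammaMeasure, ae_withDensity_iff (f := gammaPDF a r) (measurable_gammaPDFReal a r).ennreal_ofReal]
  filter_upwards [Measure.ae_ne volume (0 : ℝ)] with x hx hpdf
  by_contra h
  exact hpdf (gammaPDF_of_neg (lt_of_le_of_ne (not_lt.1 h) hx))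

lemma integral_rpow_gammaMeasure {a s : ℝ} (ha : 0 < a) (hs : 0 ≤ s) :
    ∫ x, x ^ s ∂gammaMeasure a 1 = Real.Gamma (a + s) / Real.Gamma a := by
  rw [integral_gammaMeasure a 1 ha one_pos]
  have h := Real.integral_rpow_mul_exp_neg_mul_Ioi (a := a + s) (by linarith) one_pos
  rw [one_div_one, Real.one_rpow, one_mul] at h
  rw [← h, div_eq_inv_mul (∫ _ in _, _), ← integral_const_mul]
  refine setIntegral_congr_fun measurableSet_Ioi fun x hx => ?_
  rw [show a + s - 1 = (a - 1) + s by ring, Real.rpow_add hx, Real.one_rpow]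
  ring

lemma integrable_rpow_gammaMeasure {a s : ℝ} (ha : 0 < a) (hs : 0 ≤ s) :
    Integrable (fun x => x ^ s) (gammaMeasure a 1) :=
  -- The integral of a non-integrable function is zero by convention, so the nonzero value suffices.
  .of_integral_ne_zero <| by
    rw [integral_rpow_gammaMeasure ha hs]
    exact (div_pos (Real.Gamma_pos_of_pos (by linarith)) (Real.Gamma_pos_of_pos ha)).ne'

lemma integrable_abs_pow_gaussianReal (k : ℕ) (μ : ℝ) (v : NNReal) :
    Integrable (fun z => |z| ^ k) (gaussianReal μ v) := by
  simpa using (memLp_id_gaussianReal (μ := μ) (v := v) k).integrable_norm_pow'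

lemma integral_abs_gaussianReal_zero_one :
    ∫ z, |z| ∂gaussianReal 0 1 = √(2 / Real.pi) := by
  rw [integral_gaussianReal_eq_integral_smul one_ne_zero]
  have h := integral_rpow_mul_exp_neg_mul_rpow (p := 2) (q := 1) (b := 1 / 2) (by norm_num)
    (by norm_num) (by norm_num)
  have h1 : ∀ z, gaussianPDFReal 0 1 z • |z| =
      (fun x => (√(2 * Real.pi))⁻¹ * (x ^ (1 : ℝ) * Real.exp (-(1 / 2) * x ^ (2 : ℝ)))) |z| := by
    intro z
    simp only [gaussianPDFReal, NNReal.coe_one, mul_one, sub_zero, smul_eq_mul, Real.rpow_one,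
      Real.rpow_two, sq_abs]
    ring_nf
  simp_rw [h1]
  rw [integral_comp_abs (f := fun x : ℝ =>
    (√(2 * Real.pi))⁻¹ * (x ^ (1 : ℝ) * Real.exp (-(1 / 2) * x ^ (2 : ℝ)))),
    integral_const_mul, h]
  norm_num
  have : √2 * √2 = 2 := Real.mul_self_sqrt (by norm_num)
  field_simp
  linarith

lemma integral_sq_gaussianReal_zero_one : ∫ z, z ^ 2 ∂gaussianReal 0 1 = 1 := by
  have h := variance_id_gaussianReal (μ := 0) (v := 1)
  rw [variance_eq_integral (by fun_prop)] at h
  simpa using h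

section Moments

variable {a b : ℝ}

lemma isProbabilityMeasure_svgMeasure (ha : 0 < a) (b m : ℝ) :
    IsProbabilityMeasure (svgMeasure a b m) := by
  have := isProbabilityMeasure_gammaMeasure ha one_pos
  exact Measure.isProbabilityMeasure_map (by fun_prop)

/-- Separates `G` from `Z`, so that moments factor over the product measure. -/
lemma abs_pow_sqrt_mul_ae_eq (hb : 0 < b) (k : ℕ) :
    (fun p : ℝ × ℝ => |0 + √(b * p.1) * p.2| ^ k) =ᵐ[(gammaMeasure a 1).prod (gaussianReal 0 1)]
      fun p => (√b ^ k * p.1 ^ (k / 2 : ℝ)) * |p.2| ^ k := by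
  have h : ∀ᵐ p : ℝ × ℝ ∂(gammaMeasure a 1).prod (gaussianReal 0 1), 0 < p.1 :=
    Measure.quasiMeasurePreserving_fst.ae (ae_pos_gammaMeasure a 1)
  filter_upwards [h] with p hp
  rw [zero_add, abs_mul, abs_of_nonneg (Real.sqrt_nonneg _), mul_pow, Real.sqrt_mul hb.le, mul_pow,
    ← Real.rpow_natCast (√p.1), Real.sqrt_eq_rpow p.1, ← Real.rpow_mul hp.le]
  ring_nf

lemma integrable_abs_pow_svgMeasure (ha : 0 < a) (hb : 0 < b) (k : ℕ) :
    Integrable (fun x => |x| ^ k) (svgMeasure a b 0) := by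
  have := isProbabilityMeasure_gammaMeasure ha one_pos
  rw [svgMeasure, integrable_map_measure (by fun_prop) (by fun_prop)]
  refine Integrable.congr ?_ (abs_pow_sqrt_mul_ae_eq hb k).symm
  exact ((integrable_rpow_gammaMeasure ha (by positivity)).const_mul (√b ^ k)).mul_prod
    (integrable_abs_pow_gaussianReal k 0 1)

lemma integral_abs_pow_svgMeasure (ha : 0 < a) (hb : 0 < b) (k : ℕ) :
    ∫ x, |x| ^ k ∂svgMeasure a b 0 =
      √b ^ k * (Real.Gamma (a + k / 2) / Real.Gamma a) * ∫ z, |z| ^ k ∂gaussianReal 0 1 := by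
  have := isProbabilityMeasure_gammaMeasure ha one_pos
  rw [svgMeasure, integral_map (by fun_prop) (by fun_prop),
    integral_congr_ae (abs_pow_sqrt_mul_ae_eq hb k),
    integral_prod_mul (fun x => √b ^ k * x ^ (k / 2 : ℝ)) (fun z => |z| ^ k), integral_const_mul,
    integral_rpow_gammaMeasure ha (by positivity)]

lemma integral_abs_svgMeasure (ha : 0 < a) (hb : 0 < b) :
    ∫ x, |x| ∂svgMeasure a b 0 =
      √b * (Real.Gamma (a + 1 / 2) / Real.Gamma a) * √(2 / Real.pi) := by
  simpa [integral_abs_gaussianReal_zero_one] using integral_abs_pow_svgMeasure ha hb 1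

lemma integral_sq_svgMeasure (ha : 0 < a) (hb : 0 < b) :
    ∫ x, x ^ 2 ∂svgMeasure a b 0 = a * b := by
  have h := integral_abs_pow_svgMeasure ha hb 2
  simp only [sq_abs, integral_sq_gaussianReal_zero_one, Real.sq_sqrt hb.le] at h
  rw [h]
  have := (Real.Gamma_pos_of_pos ha).ne'
  norm_num [Real.Gamma_add_one ha.ne']
  field_simp

lemma integral_abs_svgMeasure_pos (ha : 0 < a) (hb : 0 < b) :
    0 < ∫ x, |x| ∂svgMeasure a b 0 := by
  rw [integral_abs_svgMeasure ha hb]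
  have h1 := Real.Gamma_pos_of_pos ha
  have h2 := Real.Gamma_pos_of_pos (by linarith : 0 < a + 1 / 2)
  have := Real.pi_pos
  positivity

/-- Identifies the shape: both `½ ln E[X²]` and `ln E|X|` contain `½ ln b`, which cancels. -/
lemma log_moment_ratio_svgMeasure (ha : 0 < a) (hb : 0 < b) :
    1 / 2 * Real.log (∫ x, x ^ 2 ∂svgMeasure a b 0) - Real.log (∫ x, |x| ∂svgMeasure a b 0)
      = svgL a := by
  have h1 := (Real.Gamma_pos_of_pos ha).ne'
  have h2 := (Real.Gamma_pos_of_pos (by linarith : 0 < a + 1 / 2)).ne'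
  have h3 := Real.pi_pos
  rw [integral_sq_svgMeasure ha hb, integral_abs_svgMeasure ha hb, Real.log_mul ha.ne' hb.ne',
    Real.log_mul (by positivity) (by positivity), Real.log_mul (by positivity) (by positivity),
    Real.log_div h2 h1, Real.log_sqrt hb.le, Real.log_sqrt (by positivity), svgL,
    Real.log_div h3.ne' two_ne_zero, Real.log_div two_ne_zero h3.ne']
  ring

/-- The pair of statistics `(|x|, x²)` as a Euclidean vector. -/
noncomputable def absSq (x : ℝ) : EuclideanSpace ℝ (Fin 2) := !₂[ |x|, x ^ 2]

lemma measurable_absSq : Measurable absSq := by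
  unfold absSq
  fun_prop

lemma memLp_absSq (ha : 0 < a) (hb : 0 < b) : MemLp absSq 2 (svgMeasure a b 0) := by
  refine MemLp.of_eval_piLp fun i => ?_
  fin_cases i
  · rw [memLp_two_iff_integrable_sq (by simp [absSq]; fun_prop)]
    simpa [absSq] using integrable_abs_pow_svgMeasure ha hb 2
  · rw [memLp_two_iff_integrable_sq (by simp [absSq]; fun_prop)]
    simpa [absSq, ← pow_mul, Even.pow_abs (by decide : Even 4)] using
      integrable_abs_pow_svgMeasure ha hb 4

end Moments

/-! ### The estimators as a differentiable map of the moments -/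

/-- The pair of estimators as a function of the pair `(Â', V̂')` of empirical moments. -/
noncomputable def momentEst (u : EuclideanSpace ℝ (Fin 2)) : EuclideanSpace ℝ (Fin 2) :=
  !₂[svgEll (1 / 2 * Real.log (u 1) - Real.log (u 0)),
    u 1 / svgEll (1 / 2 * Real.log (u 1) - Real.log (u 0))]

lemma measurable_momentEst : Measurable momentEst := by
  have h : Measurable fun u : EuclideanSpace ℝ (Fin 2) =>
      svgEll (1 / 2 * Real.log (u 1) - Real.log (u 0)) :=
    measurable_svgEll.comp (by fun_prop)
  unfold momentEst
  refine (PiLp.continuous_toLp 2 _).measurable.comp (measurable_pi_iff.2 fun i => ?_)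
  fin_cases i
  · exact h
  · exact Measurable.div (by fun_prop) h

lemma differentiableAt_momentEst {a : ℝ} (ha : 0 < a) {u : EuclideanSpace ℝ (Fin 2)}
    (h0 : u 0 ≠ 0) (h1 : u 1 ≠ 0) (hu : 1 / 2 * Real.log (u 1) - Real.log (u 0) = svgL a) :
    DifferentiableAt ℝ momentEst u := by
  have hp (i : Fin 2) : DifferentiableAt ℝ (fun u : EuclideanSpace ℝ (Fin 2) => u i) u :=
    (EuclideanSpace.proj (𝕜 := ℝ) i).differentiableAt
  have hr : DifferentiableAt ℝ (fun u : EuclideanSpace ℝ (Fin 2) =>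
      1 / 2 * Real.log (u 1) - Real.log (u 0)) u :=
    (((hp 1).log h1).const_mul _).sub ((hp 0).log h0)
  have h : DifferentiableAt ℝ (fun u : EuclideanSpace ℝ (Fin 2) =>
      svgEll (1 / 2 * Real.log (u 1) - Real.log (u 0))) u := by
    refine DifferentiableAt.comp (g := svgEll) u ?_ hr
    rw [hu]
    exact (hasDerivAt_svgEll ha).differentiableAt
  refine (differentiableAt_euclidean (𝕜 := ℝ)).2 fun i => ?_
  fin_cases i
  · exact h
  · have hne : svgEll (1 / 2 * Real.log (u 1) - Real.log (u 0)) ≠ 0 := by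
      rw [hu, svgEll_svgL ha]
      exact ha.ne'
    exact (hp 1).fun_mul ((differentiableAt_inv hne).comp u h)

/-- The pair of empirical moments. -/
noncomputable def empMoments (x : ℕ → ℝ) (N : ℕ) : EuclideanSpace ℝ (Fin 2) :=
  !₂[empAbsMoment x N, empSecondMoment x N]

lemma momentEst_empMoments (x : ℕ → ℝ) (N : ℕ) :
    momentEst (empMoments x N) = !₂[shapeEst x N, scaleEst x N] := rfl

lemma empMoments_eq (x : ℕ → ℝ) (N : ℕ) :
    empMoments x N = (N : ℝ)⁻¹ • ∑ j ∈ Finset.range N, absSq (x j) := by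
  ext i
  fin_cases i <;>
    simp [empMoments, empAbsMoment, empSecondMoment, absSq, div_eq_inv_mul]

lemma sqrt_smul_empMoments_sub (x : ℕ → ℝ) (N : ℕ) (θ : EuclideanSpace ℝ (Fin 2)) :
    √(N : ℝ) • (empMoments x N - θ) =
      (√(N : ℝ))⁻¹ • (∑ j ∈ Finset.range N, absSq (x j) - (N : ℝ) • θ) := by
  rcases eq_or_ne N 0 with rfl | hN
  · simp
  have hN' : (0 : ℝ) < N := by positivity
  rw [empMoments_eq, smul_sub, smul_sub, smul_smul, smul_smul]
  congr 2
  · rw [← div_eq_mul_inv, Real.sqrt_div_self']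
    simp
  · rw [← div_eq_inv_mul, Real.div_sqrt]

/-- The vector of the first absolute and the second moment of the law. -/
noncomputable def svgMoments (a b : ℝ) : EuclideanSpace ℝ (Fin 2) :=
  ∫ x, absSq x ∂svgMeasure a b 0

/-! ### Consistency and asymptotic normality -/

section Asymptotics

variable {a b : ℝ}

lemma integrable_absSq (ha : 0 < a) (hb : 0 < b) : Integrable absSq (svgMeasure a b 0) := by
  have := isProbabilityMeasure_svgMeasure ha b 0
  exact (memLp_absSq ha hb).integrable (by norm_num)

lemma svgMoments_zero (ha : 0 < a) (hb : 0 < b) :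
    svgMoments a b 0 = ∫ x, |x| ∂svgMeasure a b 0 :=
  eval_integral_piLp (fun i => (integrable_absSq ha hb).eval_piLp i) 0

lemma svgMoments_one (ha : 0 < a) (hb : 0 < b) :
    svgMoments a b 1 = ∫ x, x ^ 2 ∂svgMeasure a b 0 :=
  eval_integral_piLp (fun i => (integrable_absSq ha hb).eval_piLp i) 1

lemma svgMoments_zero_pos (ha : 0 < a) (hb : 0 < b) : 0 < svgMoments a b 0 := by
  rw [svgMoments_zero ha hb]
  exact integral_abs_svgMeasure_pos ha hb

lemma svgMoments_one_pos (ha : 0 < a) (hb : 0 < b) : 0 < svgMoments a b 1 := by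
  rw [svgMoments_one ha hb, integral_sq_svgMeasure ha hb]
  exact mul_pos ha hb

lemma log_ratio_svgMoments (ha : 0 < a) (hb : 0 < b) :
    1 / 2 * Real.log (svgMoments a b 1) - Real.log (svgMoments a b 0) = svgL a := by
  rw [svgMoments_one ha hb, svgMoments_zero ha hb, log_moment_ratio_svgMeasure ha hb]

lemma momentEst_svgMoments (ha : 0 < a) (hb : 0 < b) : momentEst (svgMoments a b) = !₂[a, b] := by
  rw [momentEst, log_ratio_svgMoments ha hb, svgEll_svgL ha, svgMoments_one ha hb,
    integral_sq_svgMeasure ha hb, mul_div_cancel_left₀ _ ha.ne']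

lemma differentiableAt_momentEst_svgMoments (ha : 0 < a) (hb : 0 < b) :
    DifferentiableAt ℝ momentEst (svgMoments a b) :=
  differentiableAt_momentEst ha (svgMoments_zero_pos ha hb).ne' (svgMoments_one_pos ha hb).ne'
    (log_ratio_svgMoments ha hb)

/-- The asymptotic covariance matrix of the pair of estimators. -/
noncomputable def estCovariance (a b : ℝ) : Matrix (Fin 2) (Fin 2) ℝ :=
  covarianceMatrix ((multivariateGaussian 0
    (covarianceMatrix ((svgMeasure a b 0).map absSq))).map
      (fderiv ℝ momentEst (svgMoments a b)))

variable {Ω : Type*} [MeasurableSpace Ω] {P : Measure Ω} {X : ℕ → Ω → ℝ}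

lemma identDistrib_of_hasLaw (hX : ∀ j, HasLaw (X j) (svgMeasure a b 0) P) (i : ℕ) :
    IdentDistrib (X i) (X 0) P P :=
  ⟨(hX i).aemeasurable, (hX 0).aemeasurable, by rw [(hX i).map_eq, (hX 0).map_eq]⟩

lemma integral_absSq_comp (hX : HasLaw (X 0) (svgMeasure a b 0) P) :
    ∫ ω, absSq (X 0 ω) ∂P = svgMoments a b :=
  hX.integral_comp measurable_absSq.aestronglyMeasurable

lemma memLp_absSq_comp (ha : 0 < a) (hb : 0 < b) (hX : HasLaw (X 0) (svgMeasure a b 0) P) :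
    MemLp (fun ω => absSq (X 0 ω)) 2 P := by
  have h := memLp_absSq ha hb
  rw [← hX.map_eq] at h
  exact h.comp_of_map hX.aemeasurable

variable [IsProbabilityMeasure P]

theorem ae_tendsto_empMoments (ha : 0 < a) (hb : 0 < b) (hind : iIndepFun X P)
    (hX : ∀ j, HasLaw (X j) (svgMeasure a b 0) P) :
    ∀ᵐ ω ∂P, Tendsto (fun N => empMoments (fun j => X j ω) N) atTop (𝓝 (svgMoments a b)) := by
  have h := strong_law_ae (μ := P) (fun j ω => absSq (X j ω))
    ((memLp_absSq_comp ha hb (hX 0)).integrable (by norm_num))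
    (fun i j hij => (hind.indepFun hij).comp measurable_absSq measurable_absSq)
    (fun i => (identDistrib_of_hasLaw hX i).comp measurable_absSq)
  rw [integral_absSq_comp (hX 0)] at h
  simpa only [empMoments_eq] using h

lemma tendsto_empLogRatio (ha : 0 < a) (hb : 0 < b) {x : ℕ → ℝ}
    (h : Tendsto (empMoments x) atTop (𝓝 (svgMoments a b))) :
    Tendsto (empLogRatio x) atTop (𝓝 (svgL a)) := by
  have hp (i : Fin 2) : Tendsto (fun N => empMoments x N i) atTop (𝓝 (svgMoments a b i)) :=
    ((EuclideanSpace.proj (𝕜 := ℝ) i).continuous.tendsto _).comp h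
  rw [← log_ratio_svgMoments ha hb]
  exact (((hp 1).log (svgMoments_one_pos ha hb).ne').const_mul _).sub
    ((hp 0).log (svgMoments_zero_pos ha hb).ne')

lemma tendsto_shapeEst_scaleEst (ha : 0 < a) (hb : 0 < b) {x : ℕ → ℝ}
    (h : Tendsto (empMoments x) atTop (𝓝 (svgMoments a b))) :
    Tendsto (fun N => (shapeEst x N, scaleEst x N)) atTop (𝓝 (a, b)) := by
  have h1 := (differentiableAt_momentEst_svgMoments ha hb).continuousAt.tendsto.comp h
  rw [momentEst_svgMoments ha hb] at h1
  exact (((EuclideanSpace.proj (𝕜 := ℝ) 0).continuous.tendsto _).comp h1).prodMk_nhds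
    (((EuclideanSpace.proj (𝕜 := ℝ) 1).continuous.tendsto _).comp h1)

theorem tendstoInDistribution_empMoments (ha : 0 < a) (hb : 0 < b) (hind : iIndepFun X P)
    (hX : ∀ j, HasLaw (X j) (svgMeasure a b 0) P) :
    TendstoInDistribution
      (fun (N : ℕ) ω => √(N : ℝ) • (empMoments (fun j => X j ω) N - svgMoments a b)) atTop id
      (fun _ => P)
      (multivariateGaussian 0 (covarianceMatrix ((svgMeasure a b 0).map absSq))) := by
  have := isProbabilityMeasure_svgMeasure ha b 0
  have hY := memLp_absSq_comp ha hb (hX 0)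
  have h := tendstoInDistribution_inv_sqrt_smul_sum_sub (P := P)
    (Y := fun j ω => absSq (X j ω)) (HasLaw.id (μ := multivariateGaussian 0
      (covarianceMatrix ((svgMeasure a b 0).map absSq))))
    (by simp) (fun t => ?_) hY
    (hind.comp (fun _ => absSq) fun _ => measurable_absSq)
    (fun i => (identDistrib_of_hasLaw hX i).comp measurable_absSq)
  · simpa only [integral_absSq_comp (hX 0), ← sqrt_smul_empMoments_sub] using h
  -- The covariance hypothesis of the central limit theorem: the variance of each projection is
  -- computed under the law of `(|X|, X²)`.
  · have hlaw : HasLaw (fun ω => absSq (X 0 ω)) ((svgMeasure a b 0).map absSq) P :=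
      ⟨measurable_absSq.comp_aemeasurable (hX 0).aemeasurable, by
        rw [← (hX 0).map_eq, AEMeasurable.map_map_of_aemeasurable
          measurable_absSq.aemeasurable (hX 0).aemeasurable]; rfl⟩
    have : IsProbabilityMeasure ((svgMeasure a b 0).map absSq) :=
      Measure.isProbabilityMeasure_map measurable_absSq.aemeasurable
    have hid : MemLp id 2 ((svgMeasure a b 0).map absSq) :=
      (memLp_map_measure_iff (by fun_prop) measurable_absSq.aemeasurable).2 (memLp_absSq ha hb)
    rw [covarianceBilin_multivariateGaussian (posSemidef_covarianceMatrix _),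
      dotProduct_covarianceMatrix_mulVec, covarianceBilin_self hid, ← hlaw.map_eq,
      variance_map (by fun_prop) hlaw.aemeasurable]
    rfl

theorem tendstoInDistribution_shapeEst_scaleEst (ha : 0 < a) (hb : 0 < b) (hind : iIndepFun X P)
    (hX : ∀ j, HasLaw (X j) (svgMeasure a b 0) P) :
    TendstoInDistribution
      (fun (N : ℕ) (ω : Ω) =>
        (!₂[√(N : ℝ) * (shapeEst (fun j => X j ω) N - a),
            √(N : ℝ) * (scaleEst (fun j => X j ω) N - b)] : EuclideanSpace ℝ (Fin 2)))
      atTop id (fun _ => P) (multivariateGaussian 0 (estCovariance a b)) := by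
  set γ := multivariateGaussian 0 (covarianceMatrix ((svgMeasure a b 0).map absSq))
  set D := fderiv ℝ momentEst (svgMoments a b)
  have hm (N : ℕ) : AEMeasurable (fun ω => empMoments (fun j => X j ω) N) P := by
    simp only [empMoments_eq]
    have := fun j => measurable_absSq.comp_aemeasurable (hX j).aemeasurable
    simp only [Function.comp_def] at this
    fun_prop
  have h := (tendstoInDistribution_empMoments ha hb hind hX).of_hasFDerivAt hm
    (ae_tendsto_empMoments ha hb hind hX) measurable_momentEst
    (differentiableAt_momentEst_svgMoments ha hb).hasFDerivAt
  have hmean : ∫ x, x ∂(γ.map D) = 0 := by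
    have := ContinuousLinearMap.integral_id_map (μ := γ) IsGaussian.integrable_id D
    simpa [γ] using this
  -- A linear image of a centred Gaussian is a centred Gaussian, and `estCovariance` is by
  -- definition its covariance matrix.
  have hlim : γ.map D = multivariateGaussian 0 (estCovariance a b) := by
    conv_lhs => rw [IsGaussian.eq_multivariateGaussian (γ.map D), hmean]
    rfl
  have h' := h.congr (Y := fun (N : ℕ) (ω : Ω) =>
        (!₂[√(N : ℝ) * (shapeEst (fun j => X j ω) N - a),
            √(N : ℝ) * (scaleEst (fun j => X j ω) N - b)] : EuclideanSpace ℝ (Fin 2)))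
      (T := fun ω => D ω) (fun N => ae_of_all _ fun ω => ?_) .rfl
  · exact ⟨h'.forall_aemeasurable, aemeasurable_id, by
      have ht := h'.tendsto
      convert! ht using 2
      exact congrArg 𝓝 (Subtype.ext (Measure.map_id.trans hlim.symm))⟩
  · rw [momentEst_svgMoments ha hb, momentEst_empMoments]
    ext i
    fin_cases i <;> simp

end Asymptotics

theorem theorem6 (a b : ℝ) (ha : 0 < a) (hb : 0 < b) :
    -- `ℓ` is a genuine inverse `(½ ln(π/2), ∞) → (0, ∞)`
    Set.BijOn svgL (Set.Ioi 0) (Set.Ioi (1 / 2 * Real.log (Real.pi / 2))) ∧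
    -- the limiting covariance matrix depends only on `a` and `b`
    ∃ S : Matrix (Fin 2) (Fin 2) ℝ, S.PosSemidef ∧
      ∀ (Ω : Type u) [MeasurableSpace Ω] (P : Measure Ω) [IsProbabilityMeasure P]
        (X : ℕ → Ω → ℝ), iIndepFun X P → (∀ j, HasLaw (X j) (svgMeasure a b 0) P) →
        -- almost surely the estimators are well defined for all large `N`
        (∀ᵐ ω ∂P, ∀ᶠ N : ℕ in atTop,
          1 / 2 * Real.log (Real.pi / 2) < empLogRatio (fun j => X j ω) N) ∧
        -- consistency
        (∀ᵐ ω ∂P, Tendsto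
          (fun N : ℕ => (shapeEst (fun j => X j ω) N, scaleEst (fun j => X j ω) N))
          atTop (𝓝 (a, b))) ∧
        -- asymptotic normality
        TendstoInDistribution
          (fun (N : ℕ) (ω : Ω) =>
            (!₂[√(N : ℝ) * (shapeEst (fun j => X j ω) N - a),
                √(N : ℝ) * (scaleEst (fun j => X j ω) N - b)] : EuclideanSpace ℝ (Fin 2)))
          atTop id (fun _ => P) (multivariateGaussian 0 S) := by
  refine ⟨bijOn_svgL, estCovariance a b, posSemidef_covarianceMatrix _, ?_⟩
  intro Ω _ P _ X hind hX
  have h := ae_tendsto_empMoments ha hb hind hX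
  -- The limit `L(a)` lies strictly above `½ ln(π/2)`, so the statistic eventually does too.
  exact ⟨h.mono fun ω hω => (tendsto_empLogRatio ha hb hω).eventually_const_lt (lt_svgL ha),
    h.mono fun ω hω => tendsto_shapeEst_scaleEst ha hb hω,
    tendstoInDistribution_shapeEst_scaleEst ha hb hind hX⟩
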